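/- For a finite connected graph $G$ let $W(G)=\frac12\sum_{u,w}d_G(u,w)$ be its Wiener index, the sum being over all ordered pairs of vertices. Let $k,m,d,t$ be integers with $k,m\ge 1$ and $0\le t\le d$. The graph $L_{d,t}(k,m)$ has the vertices $u_0,\dots,u_d$, $u'_t$, and $v^i_{1j}$, $v^i_{2j}$, $v_i$ for $1\le i\le m$, $1\le j\le k$. Its edges are those of the paths $(u_0,v^i_{1j},v^i_{2j},v_i)$ for all $i,j$, all pairs $v^{i_1}_{1j_1}v^{i_2}_{1j_2}$ with $i_1\ne i_2$, those of the path $(u_0,u_1,\dots,u_d)$, and $u_tu'_t$. For $m\ge 7$ and $z\in\mathbb Z$ put $$d'=\left\lfloor\frac{\sqrt{8km-48k-8m+33+8z}+1}{2}\right\rfloor,\qquad t'=km-6k-m+3+z-\frac{(d'+1)(d'-2)}{2}.$$ Fix $m\ge 7$ and $z\in\mathbb Z$. For all sufficiently large $k$ one has $0\le t'\le d'$, so that the modified lily graph $L'(k,m,z)=L_{d',t'}(k,m)$ is defined. For all sufficiently large $k$, moreover, $G=L'(k,m,z)$ is connected, and for every vertex $v=v^i_{1j}$ the graph $G-v$ is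 connected and $W(G)-W(G-v)=z$. Finally, the proportion $$\frac{\left|\{v\in V(G) : G-v\text{ is connected and }W(G)-W(G-v)=z\}\right|}{|V(G)|},\qquad G=L'(k,m,z),$$ tends to $\frac12$ as $k\to\infty$. -/

import Mathlib

open Filter Topology

/-- The Wiener index: half the sum of the distances over all ordered pairs of vertices
(the diagonal contributes `0`). It is only used for connected graphs. -/
noncomputable def wienerIndex {V : Type*} [Fintype V] (G : SimpleGraph V) : ℚ :=
  (1 / 2) * ∑ u : V, ∑ w : V, (G.dist u w : ℚ)

/-- The graph `G - v`. -/
def removeVertex {V : Type*} (G : SimpleGraph V) (v : V) : SimpleGraph {w : V // w ≠ v} :=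
  G.comap Subtype.val

open scoped Classical in
/-- `G - v` is connected and `W(G) - W(G - v) = z`. -/
def IsWienerGood {V : Type*} [Fintype V] (G : SimpleGraph V) (z : ℤ) (v : V) : Prop :=
  (removeVertex G v).Connected ∧ wienerIndex G - wienerIndex (removeVertex G v) = (z : ℚ)

/-- The proportion of the vertices `v` of `G` with `W(G) - W(G - v) = z`. -/
noncomputable def goodProportion {V : Type*} [Fintype V] (G : SimpleGraph V) (z : ℤ) : ℝ :=
  ({v : V | IsWienerGood G z v}.ncard : ℝ) / (Fintype.card V : ℝ)

/-- The vertices of a lily graph with `m` blocks of `k` petals and a pendant path of length `d`: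
`path s` is `u_s` (so `path 0` is `u_0`), `leaf` is `u'_t`, `inner i j` is `v^i_{1j}`,
`outer i j` is `v^i_{2j}` and `tip i` is `v_i`. -/
inductive LilyVertex (k m d : ℕ) : Type
  | path (s : Fin (d + 1)) : LilyVertex k m d
  | leaf : LilyVertex k m d
  | inner (i : Fin m) (j : Fin k) : LilyVertex k m d
  | outer (i : Fin m) (j : Fin k) : LilyVertex k m d
  | tip (i : Fin m) : LilyVertex k m d

/-- The obvious bijection of the vertices with a disjoint union of finite types. -/
def LilyVertex.equivSum (k m d : ℕ) :
    LilyVertex k m d ≃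
      (Fin (d + 1) ⊕ Unit) ⊕ ((Fin m × Fin k) ⊕ (Fin m × Fin k)) ⊕ Fin m where
  toFun
    | .path s => .inl (.inl s)
    | .leaf => .inl (.inr ())
    | .inner i j => .inr (.inl (.inl (i, j)))
    | .outer i j => .inr (.inl (.inr (i, j)))
    | .tip i => .inr (.inr i)
  invFun
    | .inl (.inl s) => .path s
    | .inl (.inr ()) => .leaf
    | .inr (.inl (.inl (i, j))) => .inner i j
    | .inr (.inl (.inr (i, j))) => .outer i j
    | .inr (.inr i) => .tip i
  left_inv := by rintro (_ | _ | _ | _ | _) <;> rfl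
  right_inv := by rintro ((_ | _) | (_ | _) | _) <;> rfl

instance LilyVertex.instFintype (k m d : ℕ) : Fintype (LilyVertex k m d) :=
  Fintype.ofEquiv _ (LilyVertex.equivSum k m d).symm

/-- The edges of a lily graph, each listed in at least one direction: the paths
`(u_0, v^i_{1j}, v^i_{2j}, v_i)`, the complete multipartite graph on the `v^i_{1j}`,
the path `(u_0, …, u_d)` and the pendant edge `(u_t, u'_t)`. -/
def lilyRel (k m d t : ℕ) : LilyVertex k m d → LilyVertex k m d → Prop
  | .path s, .inner _ _ => s.val = 0
  | .inner i j, .outer i' j' => i = i' ∧ j = j'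
  | .outer i _, .tip i' => i = i'
  | .inner i _, .inner i' _ => i ≠ i'
  | .path s, .path s' => s.val + 1 = s'.val
  | .path s, .leaf => s.val = t
  | _, _ => False

/-- The lily graph with pendant path of length `d` and a leaf attached to `u_t`
(meaningful for `t ≤ d`). -/
def lilyGraph (k m d t : ℕ) : SimpleGraph (LilyVertex k m d) :=
  SimpleGraph.fromRel (lilyRel k m d t)

/-- The length `⌊(√(8km - 48k - 8m + 33 + 8z) + 1) / 2⌋` of the pendant path. -/
noncomputable def lilyD (k m : ℕ) (z : ℤ) : ℕ :=
  ⌊(Real.sqrt (8 * k * m - 48 * k - 8 * m + 33 + 8 * z) + 1) / 2⌋₊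

/-- The position `km - 6k - m + 3 + z - (d + 1)(d - 2) / 2` of the leaf; the division is exact,
as `(d + 1)(d - 2)` is even. -/
noncomputable def lilyT (k m : ℕ) (z : ℤ) : ℤ :=
  (k : ℤ) * m - 6 * k - m + 3 + z - ((lilyD k m z : ℤ) + 1) * ((lilyD k m z : ℤ) - 2) / 2

/-- The modified lily graph `L'(k, m, z)`; for `z = 0` it is the lily graph `L(k, m)`. -/
noncomputable def modifiedLily (k m : ℕ) (z : ℤ) : SimpleGraph (LilyVertex k m (lilyD k m z)) :=
  lilyGraph k m (lilyD k m z) (lilyT k m z).toNat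

/-! `W(G) - W(G - v)` is the sum of the distances from `v` minus the total growth of the distances
among the other vertices. Deleting `v^i_{1j}` leaves `v^i_{2j}` pendant at `v_i`: its distance to
each vertex outside block `i` grows by 2, and no other distance changes. Counting gives
`(d+1)(d-2)/2 + t - (km - 6k - m + 3)` (`lilyGraph_removeVertex_inner`). This equals `z` because
`d'` is the largest `d` with `(d+1)(d-2)/2 ≤ N`, where `N = km - 6k - m + 3 + z`, and `t'` is the
remainder; `m ≥ 7` makes `N` tend to infinity.

Deleting `v^i_{2j}` lowers `W` by at least `mk - 2`, which eventually exceeds `z`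
(`lilyGraph_removeVertex_outer`). So `mk` vertices are good and `mk` are not, while the remaining
`d' + 2 + m = O(√k)` are negligible, and the proportion is squeezed to `1/2`. -/

/-! ### Certifying distances by a candidate function -/

/-- A criterion computing all distances of a graph: `f` vanishes on the diagonal, changes by at most
one along edges, and can be decreased at any pair of distinct vertices by moving one of them. -/
theorem SimpleGraph.dist_le_of_exists_closer {V : Type*} {G : SimpleGraph V} {f : V → V → ℕ}
    (hf : ∀ x y, x ≠ y → (∃ y', G.Adj y' y ∧ f x y' + 1 ≤ f x y) ∨
      ∃ x', G.Adj x x' ∧ f x' y + 1 ≤ f x y) (x y : V) :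
    G.Reachable x y ∧ G.dist x y ≤ f x y := by
  suffices h : ∀ n x y, f x y ≤ n → ∃ p : G.Walk x y, p.length ≤ f x y by
    obtain ⟨p, hp⟩ := h _ x y le_rfl
    exact ⟨⟨p⟩, (SimpleGraph.dist_le p).trans hp⟩
  intro n
  induction n with
  | zero =>
    intro x y h
    by_cases hxy : x = y
    · subst hxy
      exact ⟨.nil, by simp⟩
    · rcases hf x y hxy with ⟨y', _, h'⟩ | ⟨x', _, h'⟩ <;> omega
  | succ n ih =>
    intro x y h
    by_cases hxy : x = y
    · subst hxy
      exact ⟨.nil, by simp⟩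
    · rcases hf x y hxy with ⟨y', ha, h'⟩ | ⟨x', ha, h'⟩
      · obtain ⟨p, hp⟩ := ih x y' (by omega)
        exact ⟨p.concat ha, by rw [SimpleGraph.Walk.length_concat]; omega⟩
      · obtain ⟨p, hp⟩ := ih x' y (by omega)
        exact ⟨.cons ha p, by rw [SimpleGraph.Walk.length_cons]; omega⟩

theorem SimpleGraph.le_length_of_lipschitz {V : Type*} {G : SimpleGraph V} {f : V → V → ℕ}
    (h0 : ∀ x, f x x = 0) (h1 : ∀ x y y', G.Adj y y' → f x y ≤ f x y' + 1) {x y : V}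
    (p : G.Walk y x) : f x y ≤ p.length := by
  induction p with
  | nil => simp [h0]
  | cons h p ih =>
    rw [SimpleGraph.Walk.length_cons]
    exact (h1 _ _ _ h).trans (by omega)

theorem SimpleGraph.dist_eq_of_exists_closer {V : Type*} {G : SimpleGraph V} {f : V → V → ℕ}
    (h0 : ∀ x, f x x = 0) (h1 : ∀ x y y', G.Adj y y' → f x y ≤ f x y' + 1)
    (hf : ∀ x y, x ≠ y → (∃ y', G.Adj y' y ∧ f x y' + 1 ≤ f x y) ∨
      ∃ x', G.Adj x x' ∧ f x' y + 1 ≤ f x y) (x y : V) :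
    G.Reachable x y ∧ G.dist x y = f x y := by
  obtain ⟨hr, hle⟩ := SimpleGraph.dist_le_of_exists_closer hf x y
  refine ⟨hr, le_antisymm hle ?_⟩
  obtain ⟨p, hp⟩ := hr.symm.exists_walk_length_eq_dist
  rw [SimpleGraph.dist_comm, ← hp]
  exact SimpleGraph.le_length_of_lipschitz h0 h1 p

/-! ### Distances and Wiener index after deleting a vertex -/

/-- Suppose every distance of `G` between vertices other than `v` and `o` is realised off `v` and
`o`, and that `o` has no neighbours besides `v` and `p`. Then deleting `v` makes `o` a pendant
vertex at `p` and changes no other distances. -/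
theorem removeVertex_dist_of_pendant {V : Type*} [DecidableEq V] {G : SimpleGraph V}
    {v o p : V} (hpv : p ≠ v) (hop : G.Adj o p) (ho : ∀ y, G.Adj o y → y = v ∨ y = p)
    (hG : G.Connected)
    (hc : ∀ x y, x ≠ y → x ≠ v → y ≠ v → x ≠ o → y ≠ o →
      ∃ y', G.Adj y' y ∧ y' ≠ v ∧ y' ≠ o ∧ G.dist x y' + 1 ≤ G.dist x y)
    (x y : {w : V // w ≠ v}) :
    (removeVertex G v).Reachable x y ∧ (removeVertex G v).dist x y =
      if x.1 = o then (if y.1 = o then 0 else G.dist p y + 1)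
      else if y.1 = o then G.dist x p + 1 else G.dist x y := by
  have hlip : ∀ x y y' : V, G.Adj y y' → G.dist x y ≤ G.dist x y' + 1 := by
    intro x y y' h
    have := hG.dist_triangle (u := x) (v := y') (w := y)
    rwa [(SimpleGraph.dist_eq_one_iff_adj).2 h.symm] at this
  have hpo : p ≠ o := hop.ne'
  refine SimpleGraph.dist_eq_of_exists_closer (G := removeVertex G v)
    (f := fun x y : {w : V // w ≠ v} =>
      if x.1 = o then (if y.1 = o then 0 else G.dist p y + 1)
      else if y.1 = o then G.dist x p + 1 else G.dist x y) ?_ ?_ ?_ x y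
  · intro x
    by_cases hx : x.1 = o <;> simp [hx]
  · rintro ⟨x, hx⟩ ⟨y, hy⟩ ⟨y', hy'⟩ (h : G.Adj y y')
    dsimp only
    by_cases hyo : y = o
    · have : y' = p := by
        rcases ho y' (hyo ▸ h) with h | h
        · exact absurd h hy'
        · exact h
      subst this
      simp only [hyo, hpo, if_true, if_false]
      split_ifs <;> simp
    · by_cases hyo' : y' = o
      · have : y = p := by
          rcases ho y (hyo' ▸ h.symm) with h | h
          · exact absurd h hy
          · exact h
        subst this
        simp only [hyo', hpo, if_true, if_false]
        split_ifs
        · simp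
        · omega
      · simp only [hyo, hyo', if_false]
        split_ifs
        · have := hlip p y y' h
          omega
        · exact hlip x y y' h
  · rintro ⟨x, hx⟩ ⟨y, hy⟩ hxy
    have hxy' : x ≠ y := fun h => hxy (Subtype.ext h)
    dsimp only
    by_cases hxo : x = o
    -- The hypothesis `hc` says nothing about `o`, so here the first endpoint moves, from `o` to
    -- `p`.
    · right
      refine ⟨⟨p, hpv⟩, by subst hxo; exact hop, ?_⟩
      have hyo : y ≠ o := fun h => hxy' (hxo.trans h.symm)
      simp [hxo, hyo, hpo]
    · left
      by_cases hyo : y = o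
      · exact ⟨⟨p, hpv⟩, by subst hyo; exact hop.symm, by simp [hxo, hyo, hpo]⟩
      · obtain ⟨y', ha, h1, h2, h3⟩ := hc x y hxy' hx hy hxo hyo
        exact ⟨⟨y', h1⟩, ha, by simpa [hxo, hyo, h2] using h3⟩

theorem sum_subtype_ne {V : Type*} [Fintype V] (v : V) [Fintype {w : V // w ≠ v}] (g : V → ℚ) :
    ∑ x : {w : V // w ≠ v}, g x = ∑ x, g x - g v := by
  classical
  rw [← Finset.sum_subtype (Finset.univ.erase v) (by simp) g, ← Finset.add_sum_erase _ g (Finset.mem_univ v)]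
  ring

/-- Each lengthened pair occurs in both orders, which cancels the factor 1/2; the row and the column
of `v` likewise cost one full distance sum. -/
theorem sum_dist_add_correction {V : Type*} [Fintype V] (G : SimpleGraph V) (v a : V)
    [Fintype {w : V // w ≠ v}] [DecidableEq V] (P : Finset V) (ha : a ≠ v) (hv : v ∉ P) :
    (1 / 2) * ∑ x : {w : V // w ≠ v}, ∑ y : {w : V // w ≠ v}, ((G.dist x y : ℚ) +
      (if x.1 = a then (if y.1 ∈ P then 2 else 0) else 0) +
      (if y.1 = a then (if x.1 ∈ P then 2 else 0) else 0)) =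
      wienerIndex G - ∑ w, (G.dist v w : ℚ) + 2 * P.card := by
  have h (x : V) : ∑ y : {w : V // w ≠ v}, ((G.dist x y : ℚ) +
      (if x = a then (if y.1 ∈ P then 2 else 0) else 0) +
      (if y.1 = a then (if x ∈ P then 2 else 0) else 0)) =
      ∑ y, (G.dist x y : ℚ) - G.dist x v + (if x = a then (2 * P.card : ℚ) else 0) +
        (if x ∈ P then 2 else 0) := by
    rw [sum_subtype_ne v (fun y => (G.dist x y : ℚ) +
      (if x = a then (if y ∈ P then 2 else 0) else 0) +
      (if y = a then (if x ∈ P then 2 else 0) else 0))]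
    simp only [Finset.sum_add_distrib, Finset.sum_ite_eq', Finset.mem_univ, if_true, hv, if_false,
      ha.symm]
    split_ifs <;> simp <;> ring
  simp_rw [h]
  rw [sum_subtype_ne v (fun x => ∑ y, (G.dist x y : ℚ) - G.dist x v +
    (if x = a then (2 * P.card : ℚ) else 0) + (if x ∈ P then 2 else 0))]
  simp only [Finset.sum_add_distrib, Finset.sum_sub_distrib, Finset.sum_ite_eq', Finset.mem_univ,
    if_true, hv, if_false, ha.symm, SimpleGraph.dist_self]
  simp_rw [SimpleGraph.dist_comm (u := _) (v := v)]
  simp [wienerIndex]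
  ring

/-! ### Distances in the lily graph -/

/-- The distance function of `lilyGraph k m d t`. -/
def lilyDist {k m d : ℕ} (t : ℕ) : LilyVertex k m d → LilyVertex k m d → ℕ
  | .path s, .path s' => (s.val - s'.val) + (s'.val - s.val)
  | .path s, .leaf => (s.val - t) + (t - s.val) + 1
  | .path s, .inner _ _ => s.val + 1
  | .path s, .outer _ _ => s.val + 2
  | .path s, .tip _ => s.val + 3
  | .leaf, .path s => (s.val - t) + (t - s.val) + 1
  | .leaf, .leaf => 0
  | .leaf, .inner _ _ => t + 2
  | .leaf, .outer _ _ => t + 3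
  | .leaf, .tip _ => t + 4
  | .inner _ _, .path s => s.val + 1
  | .inner _ _, .leaf => t + 2
  | .inner i j, .inner i' j' => if i = i' then (if j = j' then 0 else 2) else 1
  | .inner i j, .outer i' j' => if i = i' then (if j = j' then 1 else 3) else 2
  | .inner i _, .tip i' => if i = i' then 2 else 3
  | .outer _ _, .path s => s.val + 2
  | .outer _ _, .leaf => t + 3
  | .outer i j, .inner i' j' => if i = i' then (if j = j' then 1 else 3) else 2
  | .outer i j, .outer i' j' => if i = i' then (if j = j' then 0 else 2) else 3
  | .outer i _, .tip i' => if i = i' then 1 else 4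
  | .tip _, .path s => s.val + 3
  | .tip _, .leaf => t + 4
  | .tip i, .inner i' _ => if i = i' then 2 else 3
  | .tip i, .outer i' _ => if i = i' then 1 else 4
  | .tip i, .tip i' => if i = i' then 0 else 5

/-- A neighbour of the second vertex that is closer to the first one; `j₁` indexes the petals used
for the detours. -/
def lilyPred {k m d : ℕ} (t : Fin (d + 1)) (j₁ : Fin k) :
    LilyVertex k m d → LilyVertex k m d → LilyVertex k m d
  | .path s, .path s' =>
      -- For distinct vertices the `min` is never active; it only keeps the index in range.
      if s < s' then .path ⟨s' - 1, by omega⟩ else .path ⟨min (s' + 1) d, by omega⟩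
  | .path _, .leaf => .path t
  | .path _, .inner _ _ => .path 0
  | .path _, .outer i j => .inner i j
  | .path _, .tip i => .outer i j₁
  | .leaf, .path s' =>
      if s' = t then .leaf else
      if t < s' then .path ⟨s' - 1, by omega⟩ else .path ⟨min (s' + 1) d, by omega⟩
  | .leaf, .leaf => .leaf
  | .leaf, .inner _ _ => .path 0
  | .leaf, .outer i j => .inner i j
  | .leaf, .tip i => .outer i j₁
  | .inner i j, .path s' => if s' = 0 then .inner i j else .path ⟨s' - 1, by omega⟩
  | .inner _ _, .leaf => .path t
  | .inner i j, .inner i' _ => if i = i' then .path 0 else .inner i j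
  | .inner _ _, .outer i' j' => .inner i' j'
  | .inner i j, .tip i' => if i = i' then .outer i j else .outer i' j₁
  | .outer i j, .path s' => if s' = 0 then .inner i j else .path ⟨s' - 1, by omega⟩
  | .outer _ _, .leaf => .path t
  | .outer i j, .inner i' j' =>
      if i = i' then (if j = j' then .outer i j else .path 0) else .inner i j
  | .outer i _, .outer i' j' => if i = i' then .tip i else .inner i' j'
  | .outer i j, .tip i' => if i = i' then .outer i j else .outer i' j₁
  | .tip i, .path s' => if s' = 0 then .inner i j₁ else .path ⟨s' - 1, by omega⟩
  | .tip _, .leaf => .path t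
  | .tip i, .inner i' j' => if i = i' then .outer i j' else .inner i j₁
  | .tip i, .outer i' j' => if i = i' then .tip i else .inner i' j'
  | .tip _, .tip i' => .outer i' j₁

theorem lilyDist_self {k m d : ℕ} (t : ℕ) (x : LilyVertex k m d) : lilyDist t x x = 0 := by
  rcases x with s | _ | ⟨i, j⟩ | ⟨i, j⟩ | i <;> simp [lilyDist]

theorem lilyDist_lipschitz_of_rel {k m d t : ℕ} (x y y' : LilyVertex k m d)
    (h : lilyRel k m d t y y') :
    lilyDist t x y ≤ lilyDist t x y' + 1 ∧ lilyDist t x y' ≤ lilyDist t x y + 1 := by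
  rcases x with s | _ | ⟨i, j⟩ | ⟨i, j⟩ | i <;> rcases y with s' | _ | ⟨i', j'⟩ | ⟨i', j'⟩ | i' <;>
    rcases y' with s'' | _ | ⟨i'', j''⟩ | ⟨i'', j''⟩ | i'' <;>
    simp only [lilyRel] at h <;> simp only [lilyDist] <;> (first | omega | (split_ifs <;> simp_all))

theorem lilyDist_lipschitz {k m d t : ℕ} (x y y' : LilyVertex k m d)
    (h : (lilyGraph k m d t).Adj y y') : lilyDist t x y ≤ lilyDist t x y' + 1 := by
  rcases ((SimpleGraph.fromRel_adj _ _ _).1 h).2 with h | h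
  · exact (lilyDist_lipschitz_of_rel x y y' h).1
  · exact (lilyDist_lipschitz_of_rel x y' y h).2

theorem lilyPred_adj {k m d : ℕ} (t : Fin (d + 1)) (j₁ : Fin k) (x y : LilyVertex k m d)
    (hxy : x ≠ y) : (lilyGraph k m d t).Adj (lilyPred t j₁ x y) y := by
  refine (SimpleGraph.fromRel_adj _ _ _).2 ?_
  rcases x with s | _ | ⟨i, j⟩ | ⟨i, j⟩ | i <;> rcases y with s' | _ | ⟨i', j'⟩ | ⟨i', j'⟩ | i' <;>
    simp only [lilyPred] <;> (try split_ifs) <;> simp_all [lilyRel, Fin.ext_iff, -Fin.val_eq_zero_iff] <;> omega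

theorem lilyDist_lilyPred {k m d : ℕ} (t : Fin (d + 1)) (j₁ : Fin k) (x y : LilyVertex k m d)
    (hxy : x ≠ y) : lilyDist t x (lilyPred t j₁ x y) + 1 ≤ lilyDist t x y := by
  rcases x with s | _ | ⟨i, j⟩ | ⟨i, j⟩ | i <;> rcases y with s' | _ | ⟨i', j'⟩ | ⟨i', j'⟩ | i' <;>
    simp only [lilyPred] <;> (try split_ifs) <;> simp_all [lilyDist, Fin.ext_iff, -Fin.val_eq_zero_iff] <;>
    (first | omega | exact Nat.pos_of_ne_zero ‹_› | (split_ifs <;> simp_all))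

theorem lilyGraph_dist {k m d : ℕ} (t : Fin (d + 1)) (hk : 0 < k) (x y : LilyVertex k m d) :
    (lilyGraph k m d t).Reachable x y ∧ (lilyGraph k m d t).dist x y = lilyDist t x y :=
  SimpleGraph.dist_eq_of_exists_closer (lilyDist_self _) lilyDist_lipschitz
    (fun x y h => .inl ⟨_, lilyPred_adj t ⟨0, hk⟩ x y h, lilyDist_lilyPred t ⟨0, hk⟩ x y h⟩) x y

theorem lilyGraph_connected {k m d : ℕ} (t : Fin (d + 1)) (hk : 0 < k) :
    (lilyGraph k m d t).Connected :=
  (SimpleGraph.connected_iff _).2 ⟨fun x y => (lilyGraph_dist t hk x y).1, ⟨.leaf⟩⟩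

/-- `lilyPred` uses only petals of its two arguments and petals indexed by `j₁`, so with `j₁ ≠ j₀`
the descent avoids the deleted petal and the old distances survive. -/
theorem lilyPred_ne_of_ne {k m d : ℕ} (t : Fin (d + 1)) {i₀ : Fin m} {j₀ j₁ : Fin k}
    (hj : j₁ ≠ j₀) (x y : LilyVertex k m d) (hx : x ≠ .inner i₀ j₀) (hx' : x ≠ .outer i₀ j₀)
    (hy : y ≠ .inner i₀ j₀) (hy' : y ≠ .outer i₀ j₀) :
    lilyPred t j₁ x y ≠ .inner i₀ j₀ ∧ lilyPred t j₁ x y ≠ .outer i₀ j₀ := by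
  rcases x with s | _ | ⟨i, j⟩ | ⟨i, j⟩ | i <;> rcases y with s' | _ | ⟨i', j'⟩ | ⟨i', j'⟩ | i' <;>
    simp only [lilyPred] <;> (try split_ifs) <;> simp_all

/-- Only the pair `inner i₀ j₀`, `tip i₀` needs the deleted vertex. Descent from any other pair also
avoids this pair, whose bound is raised by 2. -/
theorem lilyPred_ne_outer {k m d : ℕ} (t : Fin (d + 1)) {i₀ : Fin m} {j₀ j₁ : Fin k}
    (hj : j₁ ≠ j₀) (x y : LilyVertex k m d) (hx : x ≠ .outer i₀ j₀) (hy : y ≠ .outer i₀ j₀)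
    (h : ¬ (x = .inner i₀ j₀ ∧ y = .tip i₀)) (h' : ¬ (x = .tip i₀ ∧ y = .inner i₀ j₀)) :
    lilyPred t j₁ x y ≠ .outer i₀ j₀ ∧
    ¬ (x = .inner i₀ j₀ ∧ lilyPred t j₁ x y = .tip i₀) ∧
    ¬ (x = .tip i₀ ∧ lilyPred t j₁ x y = .inner i₀ j₀) := by
  rcases x with s | _ | ⟨i, j⟩ | ⟨i, j⟩ | i <;> rcases y with s' | _ | ⟨i', j'⟩ | ⟨i', j'⟩ | i' <;>
    simp only [lilyPred] <;> (try split_ifs) <;> simp_all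

/-! ### Change of the Wiener index at petal vertices -/

/-- The vertices whose distance to `outer i₀ j₀` grows when `inner i₀ j₀` is deleted. -/
def IsLilyFar {k m d : ℕ} (i₀ : Fin m) : LilyVertex k m d → Prop
  | .path _ => True
  | .leaf => True
  | .inner i _ => i₀ ≠ i
  | .outer i _ => i₀ ≠ i
  | .tip i => i₀ ≠ i

theorem LilyVertex.sum_eq {k m d : ℕ} {M : Type*} [AddCommMonoid M] (g : LilyVertex k m d → M) :
    ∑ x, g x = ((∑ s, g (.path s)) + g .leaf) + (((∑ i, ∑ j, g (.inner i j)) +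
      ∑ i, ∑ j, g (.outer i j)) + ∑ i, g (.tip i)) := by
  rw [← (LilyVertex.equivSum k m d).symm.sum_comp]
  simp only [Fintype.sum_sum_type, Fintype.sum_prod_type, Finset.univ_unique, Finset.sum_singleton]
  rfl

theorem LilyVertex.card_eq (k m d : ℕ) :
    Fintype.card (LilyVertex k m d) = d + 2 + 2 * (m * k) + m := by
  rw [Fintype.card_congr (LilyVertex.equivSum k m d)]
  simp
  ring

theorem Fin.sum_ite_eq_const {m : ℕ} (i₀ : Fin m) (a c : ℚ) :
    ∑ i, (if i₀ = i then a else c) = a + (m - 1) * c := by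
  have h (i : Fin m) : (if i₀ = i then a else c) = (if i₀ = i then a - c else 0) + c := by
    split_ifs <;> ring
  simp_rw [h, Finset.sum_add_distrib]
  simp
  ring

theorem Fin.sum_sum_ite_eq_const {m k : ℕ} (i₀ : Fin m) (j₀ : Fin k) (a b c : ℚ) :
    ∑ i, ∑ j, (if i₀ = i then (if j₀ = j then a else b) else c) =
      a + (k - 1) * b + (m - 1) * (k * c) := by
  have h (i : Fin m) : ∑ j, (if i₀ = i then (if j₀ = j then a else b) else c) =
      if i₀ = i then a + (k - 1) * b else k * c := by
    split_ifs
    · exact Fin.sum_ite_eq_const j₀ a b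
    · simp
  simp_rw [h]
  exact Fin.sum_ite_eq_const i₀ _ _

theorem Fin.sum_val_add_one (d : ℕ) :
    ∑ s : Fin (d + 1), ((s.val : ℚ) + 1) = (d + 1) * (d + 2) / 2 := by
  rw [Fin.sum_univ_eq_sum_range (fun n => (n : ℚ) + 1)]
  induction d with
  | zero => norm_num
  | succ d ih => rw [Finset.sum_range_succ, ih]; push_cast; ring

theorem sum_lilyDist_inner {k m d : ℕ} (t : ℕ) (i₀ : Fin m) (j₀ : Fin k) :
    ∑ x : LilyVertex k m d, (lilyDist t (.inner i₀ j₀) x : ℚ) =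
      (d + 1) * (d + 2) / 2 + t + 3 * m * k + 2 * k + 3 * m - 3 := by
  rw [LilyVertex.sum_eq]
  simp only [lilyDist, Nat.cast_ite, Fin.sum_sum_ite_eq_const, Fin.sum_ite_eq_const]
  push_cast
  rw [Fin.sum_val_add_one]
  ring

open scoped Classical in
theorem card_isLilyFar {k m d : ℕ} (i₀ : Fin m) :
    (({x | IsLilyFar i₀ x} : Finset (LilyVertex k m d)).card : ℚ) =
      d + 2 + (m - 1) * (2 * k + 1) := by
  have h1 (s : Fin (d + 1)) : IsLilyFar i₀ (.path s : LilyVertex k m d) ↔ True := Iff.rfl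
  have h2 : IsLilyFar i₀ (.leaf : LilyVertex k m d) ↔ True := Iff.rfl
  have h3 (i : Fin m) (j : Fin k) : IsLilyFar i₀ (.inner i j : LilyVertex k m d) ↔ ¬ i₀ = i := Iff.rfl
  have h4 (i : Fin m) (j : Fin k) : IsLilyFar i₀ (.outer i j : LilyVertex k m d) ↔ ¬ i₀ = i := Iff.rfl
  have h5 (i : Fin m) : IsLilyFar i₀ (.tip i : LilyVertex k m d) ↔ ¬ i₀ = i := Iff.rfl
  rw [Finset.natCast_card_filter, LilyVertex.sum_eq]
  simp only [h1, h2, h3, h4, h5, ite_not, if_true, Finset.sum_const, Finset.card_univ, Fintype.card_fin,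
    nsmul_eq_mul, Nat.cast_add, Nat.cast_one]
  simp_rw [← Finset.mul_sum, Fin.sum_ite_eq_const]
  ring

/-- Inside block `i₀` a shortest path from `outer i₀ j₀` can start through the tip; elsewhere it
starts through `inner i₀ j₀`, and going by the tip costs 2 more. -/
theorem lilyDist_tip_add_one {k m d : ℕ} (t : ℕ) (i₀ : Fin m) (j₀ : Fin k)
    (x : LilyVertex k m d) (hx : x ≠ .inner i₀ j₀) (hx' : x ≠ .outer i₀ j₀) [Decidable (IsLilyFar i₀ x)] :
    lilyDist t (.tip i₀) x + 1 = lilyDist t (.outer i₀ j₀) x + if IsLilyFar i₀ x then 2 else 0 := by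
  rcases x with s | _ | ⟨i, j⟩ | ⟨i, j⟩ | i <;> simp only [lilyDist, IsLilyFar] <;>
    split_ifs <;> simp_all

/-- Having `k ≥ 2` supplies the detour petal `j₁`. The `Fintype` instance is left arbitrary so that
the result fits the classical one in `IsWienerGood`. -/
theorem lilyGraph_removeVertex_inner {k m d : ℕ} (t : Fin (d + 1)) (hk : 2 ≤ k) (i₀ : Fin m)
    (j₀ : Fin k) :
    (removeVertex (lilyGraph k m d t) (.inner i₀ j₀)).Connected ∧
    ∀ _ : Fintype {w : LilyVertex k m d // w ≠ .inner i₀ j₀},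
    wienerIndex (lilyGraph k m d t) -
      wienerIndex (removeVertex (lilyGraph k m d t) (.inner i₀ j₀)) =
      (d + 1) * (d - 2) / 2 + t.val - 3 - m * k + 6 * k + m := by
  classical
  have hk0 : 0 < k := by omega
  obtain ⟨j₁, hj⟩ : ∃ j₁ : Fin k, j₁ ≠ j₀ :=
    have : Nontrivial (Fin k) := Fin.nontrivial_iff_two_le.2 hk
    exists_ne j₀
  have hG := lilyGraph_connected (m := m) t hk0
  have hdist (x y : LilyVertex k m d) := (lilyGraph_dist t hk0 x y).2
  have key := removeVertex_dist_of_pendant (G := lilyGraph k m d t) (v := .inner i₀ j₀)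
    (o := .outer i₀ j₀) (p := .tip i₀) (by simp)
    ((SimpleGraph.fromRel_adj _ _ _).2 (by simp [lilyRel]))
    (by
      intro y hy
      have := (SimpleGraph.fromRel_adj _ _ _).1 hy
      rcases y with s | _ | ⟨i, j⟩ | ⟨i, j⟩ | i <;> simp_all [lilyRel])
    hG
    (by
      intro x y hxy hx hy hx' hy'
      obtain ⟨h1, h2⟩ := lilyPred_ne_of_ne t hj x y hx hx' hy hy'
      exact ⟨_, lilyPred_adj t j₁ x y hxy, h1, h2, by
        simpa only [hdist] using lilyDist_lilyPred t j₁ x y hxy⟩)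
  refine ⟨(SimpleGraph.connected_iff _).2 ⟨fun x y => (key x y).1, ⟨⟨.leaf, by simp⟩⟩⟩, ?_⟩
  intro _
  have hW := sum_dist_add_correction (lilyGraph k m d t) (.inner i₀ j₀) (.outer i₀ j₀)
    ({x | IsLilyFar i₀ x} : Finset (LilyVertex k m d)) (by simp)
    (fun h => (Finset.mem_filter.1 h).2 rfl)
  have hEq : wienerIndex (removeVertex (lilyGraph k m d t) (.inner i₀ j₀)) =
      wienerIndex (lilyGraph k m d t) - ∑ w, ((lilyGraph k m d t).dist (.inner i₀ j₀) w : ℚ) +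
        2 * ({x | IsLilyFar i₀ x} : Finset (LilyVertex k m d)).card := by
    rw [← hW, wienerIndex]
    congr 1
    refine Finset.sum_congr rfl fun x _ => Finset.sum_congr rfl fun y _ => ?_
    obtain ⟨x, hx⟩ := x
    obtain ⟨y, hy⟩ := y
    rw [(key _ _).2]
    simp only [Finset.mem_filter, Finset.mem_univ, true_and]
    have hfar : ¬ IsLilyFar i₀ (.outer i₀ j₀ : LilyVertex k m d) := by simp [IsLilyFar]
    by_cases hxo : x = .outer i₀ j₀
    · by_cases hyo : y = .outer i₀ j₀
      · simp [hxo, hyo, hfar]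
      · have := lilyDist_tip_add_one t i₀ j₀ y hy hyo
        simp only [hxo, hyo, if_true, if_false, hdist, add_zero]
        rw [this]
        push_cast
        rfl
    · by_cases hyo : y = .outer i₀ j₀
      · have := lilyDist_tip_add_one t i₀ j₀ x hx hxo
        simp only [hxo, hyo, if_true, if_false, add_zero]
        rw [SimpleGraph.dist_comm, SimpleGraph.dist_comm (u := x)]
        simp only [hdist]
        rw [this]
        push_cast
        rfl
      · simp [hxo, hyo]
  rw [hEq, card_isLilyFar]
  simp only [hdist, sum_lilyDist_inner]
  ring

/-- The `mk` inner vertices alone contribute at least `mk` to the distance sum, and a single pair is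
lengthened, by at most 2. Upper bounds on the new distances suffice. -/
theorem lilyGraph_removeVertex_outer {k m d : ℕ} (t : Fin (d + 1)) (hk : 2 ≤ k) (i₀ : Fin m)
    (j₀ : Fin k) (_ : Fintype {w : LilyVertex k m d // w ≠ .outer i₀ j₀}) :
    (m * k : ℚ) - 2 ≤ wienerIndex (lilyGraph k m d t) -
      wienerIndex (removeVertex (lilyGraph k m d t) (.outer i₀ j₀)) := by
  classical
  have hk0 : 0 < k := by omega
  obtain ⟨j₁, hj⟩ : ∃ j₁ : Fin k, j₁ ≠ j₀ :=
    have : Nontrivial (Fin k) := Fin.nontrivial_iff_two_le.2 hk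
    exists_ne j₀
  have hdist (x y : LilyVertex k m d) := (lilyGraph_dist t hk0 x y).2
  have hW := sum_dist_add_correction (lilyGraph k m d t) (.outer i₀ j₀) (.inner i₀ j₀)
    {.tip i₀} (by simp) (by simp)
  have hle (x y : {w : LilyVertex k m d // w ≠ .outer i₀ j₀}) :=
    (SimpleGraph.dist_le_of_exists_closer (G := removeVertex (lilyGraph k m d t) (.outer i₀ j₀))
    (f := fun x y => (lilyGraph k m d t).dist x y +
      (if x.1 = .inner i₀ j₀ then (if y.1 ∈ ({.tip i₀} : Finset _) then 2 else 0) else 0) +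
      (if y.1 = .inner i₀ j₀ then (if x.1 ∈ ({.tip i₀} : Finset _) then 2 else 0) else 0)) (by
      rintro ⟨x, hx⟩ ⟨y, hy⟩ hxy
      have hxy' : x ≠ y := fun h => hxy (Subtype.ext h)
      left
      simp only [Finset.mem_singleton, hdist]
      by_cases h : x = .inner i₀ j₀ ∧ y = .tip i₀
      · obtain ⟨rfl, rfl⟩ := h
        -- The detour through `u_0` and petal `j₁` has length 4 = 2 + 2.
        refine ⟨⟨.outer i₀ j₁, by simp [hj]⟩, (SimpleGraph.fromRel_adj _ _ _).2 ?_, ?_⟩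
        · simp [lilyRel]
        · simp [lilyDist, hj.symm]
      · by_cases h' : x = .tip i₀ ∧ y = .inner i₀ j₀
        · obtain ⟨rfl, rfl⟩ := h'
          refine ⟨⟨.path 0, by simp⟩, (SimpleGraph.fromRel_adj _ _ _).2 ?_, ?_⟩
          · simp [lilyRel]
          · simp [lilyDist]
        · obtain ⟨h1, h2, h3⟩ := lilyPred_ne_outer t hj x y hx hy h h'
          refine ⟨⟨_, h1⟩, lilyPred_adj t j₁ x y hxy', ?_⟩
          have := lilyDist_lilyPred t j₁ x y hxy'
          simp only [← ite_and]
          rw [if_neg h2, if_neg (fun h => h3 h.symm), if_neg h, if_neg (fun h => h' h.symm)]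
          exact this) x y).2
  have hT : (m * k : ℚ) ≤ ∑ w, ((lilyGraph k m d t).dist (.outer i₀ j₀) w : ℚ) := by
    simp only [hdist]
    rw [LilyVertex.sum_eq]
    have h1 : (m * k : ℚ) ≤ ∑ i : Fin m, ∑ j : Fin k,
        (lilyDist (d := d) t (.outer i₀ j₀) (.inner i j) : ℚ) := by
      have : (m * k : ℚ) = ∑ i : Fin m, ∑ j : Fin k, (1 : ℚ) := by simp
      rw [this]
      refine Finset.sum_le_sum fun i _ => Finset.sum_le_sum fun j _ => ?_
      rw [lilyDist]
      split_ifs <;> norm_num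
    refine h1.trans ?_
    have a1 : (0 : ℚ) ≤ ∑ s, (lilyDist t (.outer i₀ j₀ : LilyVertex k m d) (.path s) : ℚ) := by positivity
    have a2 : (0 : ℚ) ≤ (lilyDist t (.outer i₀ j₀ : LilyVertex k m d) .leaf : ℚ) := by positivity
    have a3 : (0 : ℚ) ≤ ∑ i, ∑ j, (lilyDist t (.outer i₀ j₀ : LilyVertex k m d) (.outer i j) : ℚ) := by positivity
    have a4 : (0 : ℚ) ≤ ∑ i, (lilyDist t (.outer i₀ j₀ : LilyVertex k m d) (.tip i) : ℚ) := by positivity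
    linarith
  have hW' : wienerIndex (removeVertex (lilyGraph k m d t) (.outer i₀ j₀)) ≤
      wienerIndex (lilyGraph k m d t) - ∑ w, ((lilyGraph k m d t).dist (.outer i₀ j₀) w : ℚ) +
        2 * ({.tip i₀} : Finset (LilyVertex k m d)).card := by
    rw [← hW, wienerIndex]
    refine mul_le_mul_of_nonneg_left ?_ (by norm_num)
    refine Finset.sum_le_sum fun x _ => Finset.sum_le_sum fun y _ => ?_
    exact_mod_cast hle x y
  rw [Finset.card_singleton] at hW'
  push_cast at hW'
  linarith

/-! ### The choice of `d'` and `t'` -/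

/-- The real number under the floor is the larger root of `(x+1)(x-2) = 2N`, with discriminant `8N +
9`. -/
theorem lilyD_bounds {k m : ℕ} {z : ℤ} (h : 0 ≤ (k : ℤ) * m - 6 * k - m + 3 + z) :
    ((lilyD k m z : ℤ) + 1) * ((lilyD k m z : ℤ) - 2) ≤ 2 * ((k : ℤ) * m - 6 * k - m + 3 + z) ∧
    2 * ((k : ℤ) * m - 6 * k - m + 3 + z) < ((lilyD k m z : ℤ) + 2) * ((lilyD k m z : ℤ) - 1) := by
  have hR : (0 : ℝ) ≤ (k : ℝ) * m - 6 * k - m + 3 + z := by exact_mod_cast h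
  have hX : (0 : ℝ) ≤ 8 * k * m - 48 * k - 8 * m + 33 + 8 * z := by linarith
  have hS := Real.sqrt_nonneg (8 * k * m - 48 * k - 8 * m + 33 + 8 * z : ℝ)
  have hsq := Real.sq_sqrt hX
  have h1 : (lilyD k m z : ℝ) ≤ _ := Nat.floor_le (by positivity)
  have h2 := Nat.lt_floor_add_one ((√(8 * k * m - 48 * k - 8 * m + 33 + 8 * z : ℝ) + 1) / 2)
  change _ < (lilyD k m z : ℝ) + 1 at h2
  have h0 : (0 : ℝ) ≤ lilyD k m z := Nat.cast_nonneg _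
  set S := √(8 * k * m - 48 * k - 8 * m + 33 + 8 * z : ℝ)
  set d := lilyD k m z
  constructor
  · have : ((d : ℝ) + 1) * (d - 2) ≤ 2 * ((k : ℝ) * m - 6 * k - m + 3 + z) := by
      -- Squaring `2d - 1 ≤ S` needs `2d - 1 ≥ 0`; otherwise the left side is negative.
      by_cases hd : (1 : ℝ) ≤ 2 * d
      · nlinarith
      · nlinarith
    exact_mod_cast this
  · have : 2 * ((k : ℝ) * m - 6 * k - m + 3 + z) < ((d : ℝ) + 2) * (d - 1) := by nlinarith
    exact_mod_cast this

theorem two_mul_lilyT (k m : ℕ) (z : ℤ) :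
    2 * lilyT k m z = 2 * ((k : ℤ) * m - 6 * k - m + 3 + z) -
      ((lilyD k m z : ℤ) + 1) * ((lilyD k m z : ℤ) - 2) := by
  have h : (2 : ℤ) ∣ ((lilyD k m z : ℤ) + 1) * ((lilyD k m z : ℤ) - 2) := by
    rw [← even_iff_two_dvd, Int.even_mul]
    rcases Int.even_or_odd (lilyD k m z : ℤ) with h | h
    · exact .inr (h.sub even_two)
    · exact .inl h.add_one
  rw [lilyT, mul_sub, Int.mul_ediv_cancel' h]

/-- The two bounds in `lilyD_bounds` differ by `2d'`, so the remainder lies in `[0, d')`. -/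
theorem lilyT_mem {k m : ℕ} {z : ℤ} (h : 0 ≤ (k : ℤ) * m - 6 * k - m + 3 + z) :
    0 ≤ lilyT k m z ∧ lilyT k m z ≤ (lilyD k m z : ℤ) := by
  obtain ⟨h1, h2⟩ := lilyD_bounds h
  have h3 := two_mul_lilyT k m z
  constructor <;> nlinarith

theorem modifiedLily_good {k m : ℕ} {z : ℤ} (hk : 2 ≤ k)
    (h : 0 ≤ (k : ℤ) * m - 6 * k - m + 3 + z) :
    (modifiedLily k m z).Connected ∧
    (∀ (i : Fin m) (j : Fin k), IsWienerGood (modifiedLily k m z) z (LilyVertex.inner i j)) ∧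
    (z < m * k - 2 → ∀ (i : Fin m) (j : Fin k),
      ¬ IsWienerGood (modifiedLily k m z) z (LilyVertex.outer i j)) := by
  obtain ⟨h1, h2⟩ := lilyT_mem h
  obtain ⟨t, ht⟩ : ∃ t : Fin (lilyD k m z + 1), t.val = (lilyT k m z).toNat :=
    ⟨⟨(lilyT k m z).toNat, by omega⟩, rfl⟩
  have hG : modifiedLily k m z = lilyGraph k m (lilyD k m z) t.val := by rw [modifiedLily, ht]
  rw [hG]
  refine ⟨lilyGraph_connected t (by omega), fun i j => ?_, fun hz i j hgood => ?_⟩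
  · obtain ⟨hc, hW⟩ := lilyGraph_removeVertex_inner t hk i j
    refine ⟨hc, (hW _).trans ?_⟩
    have h3 : (2 * lilyT k m z : ℚ) = 2 * ((k : ℚ) * m - 6 * k - m + 3 + z) -
      ((lilyD k m z : ℚ) + 1) * ((lilyD k m z : ℚ) - 2) := by exact_mod_cast two_mul_lilyT k m z
    have h4 : (t.val : ℚ) = lilyT k m z := by
      have : (t.val : ℤ) = lilyT k m z := by omega
      exact_mod_cast this
    linarith
  · have hle : (m * k : ℚ) - 2 ≤ z :=
      le_of_le_of_eq (lilyGraph_removeVertex_outer t hk i j _) hgood.2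
    have hz' : (z : ℚ) < m * k - 2 := by exact_mod_cast hz
    exact absurd hle (not_le.2 hz')

/-! ### The proportion of good vertices and its limit -/

theorem goodProportion_mem {k m d : ℕ} {G : SimpleGraph (LilyVertex k m d)} {z : ℤ}
    (hi : ∀ (i : Fin m) (j : Fin k), IsWienerGood G z (LilyVertex.inner i j))
    (ho : ∀ (i : Fin m) (j : Fin k), ¬ IsWienerGood G z (LilyVertex.outer i j)) :
    (m * k : ℝ) / (d + 2 + 2 * (m * k) + m) ≤ goodProportion G z ∧
    goodProportion G z ≤ 1 - (m * k : ℝ) / (d + 2 + 2 * (m * k) + m) := by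
  have hcard : (Fintype.card (LilyVertex k m d) : ℝ) = d + 2 + 2 * (m * k) + m := by
    exact_mod_cast LilyVertex.card_eq k m d
  have hpos : (0 : ℝ) < d + 2 + 2 * (m * k) + m := by positivity
  have h1 : m * k ≤ {v | IsWienerGood G z v}.ncard := by
    have hinj : Function.Injective (fun p : Fin m × Fin k => (.inner p.1 p.2 : LilyVertex k m d)) := by
      rintro ⟨a, b⟩ ⟨a', b'⟩ h
      simpa using h
    have := Set.ncard_le_ncard (s := Set.range
      (fun p : Fin m × Fin k => (.inner p.1 p.2 : LilyVertex k m d)))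
      (t := {v | IsWienerGood G z v}) (by rintro _ ⟨p, rfl⟩; exact hi p.1 p.2) (Set.toFinite _)
    rwa [← Set.image_univ, Set.ncard_image_of_injective _ hinj, Set.ncard_univ,
      Nat.card_prod, Nat.card_fin, Nat.card_fin] at this
  have h2 : m * k + {v | IsWienerGood G z v}.ncard ≤ Fintype.card (LilyVertex k m d) := by
    have hinj : Function.Injective (fun p : Fin m × Fin k => (.outer p.1 p.2 : LilyVertex k m d)) := by
      rintro ⟨a, b⟩ ⟨a', b'⟩ h
      simpa using h
    have := Set.ncard_le_ncard (s := Set.range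
      (fun p : Fin m × Fin k => (.outer p.1 p.2 : LilyVertex k m d)))
      (t := {v | IsWienerGood G z v}ᶜ) (by rintro _ ⟨p, rfl⟩; exact ho p.1 p.2) (Set.toFinite _)
    rw [← Set.image_univ, Set.ncard_image_of_injective _ hinj, Set.ncard_univ,
      Nat.card_prod, Nat.card_fin, Nat.card_fin] at this
    have hc := Set.ncard_add_ncard_compl {v | IsWienerGood G z v}
    rw [Nat.card_eq_fintype_card] at hc
    omega
  have h1' : (m * k : ℝ) ≤ ({v | IsWienerGood G z v}.ncard : ℝ) := by exact_mod_cast h1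
  have h2' : (m * k : ℝ) + ({v | IsWienerGood G z v}.ncard : ℝ) ≤ d + 2 + 2 * (m * k) + m := by
    rw [← hcard]
    exact_mod_cast h2
  rw [goodProportion, hcard, one_sub_div hpos.ne']
  constructor
  · gcongr
  · gcongr
    linarith

theorem tendsto_lilyD_div (m : ℕ) (z : ℤ) :
    Tendsto (fun k : ℕ => (lilyD k m z : ℝ) / k) atTop (𝓝 0) := by
  -- For `k ≥ 1` the radicand is at most `C k`, hence `d' = O(√k)`.
  set C : ℝ := 8 * m + 33 + 8 * |(z : ℝ)| with hC
  have hC0 : 0 ≤ C := by positivity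
  have hlim : Tendsto (fun k : ℕ => √C * (√(k : ℝ))⁻¹ + (k : ℝ)⁻¹) atTop (𝓝 0) := by
    have hk := tendsto_natCast_atTop_atTop (R := ℝ)
    simpa using ((tendsto_inv_atTop_zero.comp (Real.tendsto_sqrt_atTop.comp hk)).const_mul √C).add
      (tendsto_inv_atTop_zero.comp hk)
  refine squeeze_zero' (.of_forall fun k => by positivity) ?_ hlim
  filter_upwards [eventually_ge_atTop 1] with k hk
  have hk1 : (1 : ℝ) ≤ k := by exact_mod_cast hk
  have hsk : 0 < √(k : ℝ) := Real.sqrt_pos.2 (by linarith)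
  have hle : √(8 * k * m - 48 * k - 8 * m + 33 + 8 * z : ℝ) ≤ √C * √(k : ℝ) := by
    rw [← Real.sqrt_mul hC0]
    refine Real.sqrt_le_sqrt ?_
    have hz := le_abs_self (z : ℝ)
    have hz0 := abs_nonneg (z : ℝ)
    have hm : (0 : ℝ) ≤ m := by positivity
    rw [hC]
    nlinarith
  have h1 : (lilyD k m z : ℝ) ≤ _ := Nat.floor_le (by positivity)
  have h2 : (lilyD k m z : ℝ) ≤ √C * √(k : ℝ) + 1 := by
    have : 0 ≤ √C * √(k : ℝ) := by positivity
    linarith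
  rw [div_le_iff₀ (by linarith)]
  refine h2.trans_eq ?_
  have hkk : (√(k : ℝ))⁻¹ * k = √(k : ℝ) := by
    rw [inv_mul_eq_div, Real.div_sqrt]
  rw [add_mul, mul_assoc, hkk, inv_mul_cancel₀ (by linarith)]

theorem tendsto_inner_div_card {m : ℕ} (hm : 0 < m) (z : ℤ) :
    Tendsto (fun k : ℕ => (m * k : ℝ) / (lilyD k m z + 2 + 2 * (m * k) + m)) atTop
      (𝓝 (1 / 2)) := by
  have hm0 : (0 : ℝ) < m := by exact_mod_cast hm
  have hk := tendsto_inv_atTop_zero.comp (tendsto_natCast_atTop_atTop (R := ℝ))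
  have h := ((tendsto_lilyD_div m z).add (hk.const_mul (2 + m : ℝ))).add_const (2 * m : ℝ)
  have h' := (tendsto_const_nhds (x := (m : ℝ))).div h (by simp; exact hm.ne')
  have he : (m : ℝ) / (0 + (2 + m) * 0 + 2 * m) = 1 / 2 := by field_simp; simp
  rw [he] at h'
  refine h'.congr' ?_
  filter_upwards [eventually_ge_atTop 1] with k hk
  have hk1 : (0 : ℝ) < k := by exact_mod_cast hk
  simp only [Pi.div_apply, Function.comp_apply]
  have e : (lilyD k m z + 2 + 2 * (m * k) + m : ℝ) =
      (lilyD k m z / k + (2 + m) * (k : ℝ)⁻¹ + 2 * m) * k := by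
    field_simp
    ring
  rw [e, mul_div_mul_right _ _ hk1.ne']

theorem mainTheorem3 (m : ℕ) (hm : 7 ≤ m) (z : ℤ) :
    (∀ᶠ k : ℕ in atTop,
      0 ≤ lilyT k m z ∧ lilyT k m z ≤ (lilyD k m z : ℤ) ∧
      (modifiedLily k m z).Connected ∧
      ∀ (i : Fin m) (j : Fin k), IsWienerGood (modifiedLily k m z) z (LilyVertex.inner i j)) ∧
    Tendsto (fun k : ℕ => goodProportion (modifiedLily k m z) z) atTop (𝓝 (1 / 2)) := by
  have hlarge : ∀ᶠ k : ℕ in atTop, 2 ≤ k ∧ 0 ≤ (k : ℤ) * m - 6 * k - m + 3 + z ∧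
      z < m * k - 2 := by
    -- As `m - 6 ≥ 1`, one has `N ≥ k - m + 3 + z ≥ 0` for such `k`.
    filter_upwards [eventually_ge_atTop (m + z.natAbs + 3)] with k hk
    have hm' : (7 : ℤ) ≤ m := by exact_mod_cast hm
    have hk' : (m : ℤ) + |z| + 3 ≤ k := by
      rw [Int.abs_eq_natAbs]
      exact_mod_cast hk
    have hz := neg_abs_le z
    have hz' := le_abs_self z
    exact ⟨by omega, by nlinarith, by nlinarith⟩
  refine ⟨?_, ?_⟩
  · filter_upwards [hlarge] with k ⟨hk, hN, _⟩
    obtain ⟨hc, hi, _⟩ := modifiedLily_good hk hN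
    exact ⟨(lilyT_mem hN).1, (lilyT_mem hN).2, hc, hi⟩
  · have hlim := tendsto_inner_div_card (show 0 < m by omega) z
    have hlim' := hlim.const_sub 1
    rw [show (1 : ℝ) - 1 / 2 = 1 / 2 by norm_num] at hlim'
    refine tendsto_of_tendsto_of_tendsto_of_le_of_le' hlim hlim' ?_ ?_
    · filter_upwards [hlarge] with k ⟨hk, hN, hz⟩
      obtain ⟨_, hi, ho⟩ := modifiedLily_good hk hN
      exact (goodProportion_mem hi (ho hz)).1
    · filter_upwards [hlarge] with k ⟨hk, hN, hz⟩
      obtain ⟨_, hi, ho⟩ := modifiedLily_good hk hN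
      exact (goodProportion_mem hi (ho hz)).2
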